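/- **Setting.** Let $S$ be a non-singular curve over an algebraically closed field $k$ (an integral separated scheme of finite type over $k$, of dimension one, with regular local rings; not necessarily complete). Let $V$ be a flat quasi-coherent $\mathcal O_S$-module and $V^+\subseteq V$ a flat quasi-coherent submodule with $V/V^+$ flat. For quasi-coherent submodules $A,B\subseteq V$ with $V/A$, $V/B$ flat, write $A\sim B$ if $V/(A+B)$ and $V/(A\cap B)$ are flat and $(A+B)/(A\cap B)$ is locally free of finite type. Assume that $V=\bigcup_{A\sim V^+}A$, that $\bigcap_{A\sim V^+}A=0$, and that $V=\varprojlim_{A\sim V^+}V/A$ (inverse limits and this intersection are taken in the category of quasi-coherent modules). For an open subscheme $T\subseteq S$ let $\hat V_T=\varprojlim_{A\sim V^+}(V/A)|_T$, and let $\hat V_T^+\subseteq\hat V_T$ be the image of $\varprojlim_{A\sim V^+}(V^+/(A\cap V^+))|_T$. Let $\bar{\mathcal Q}_S(T)$ be the set of monomorphisms of $\mathcal O_T$-modules $g:\hat V_T\to\hat V_T$ such that $\hat V_T/g\hat V_T^+$ is quasi-coherent and $(\hat V_T^++g\hat V_T^+)/\hat V_T^+$, $(\hat V_T^++g\hat V_T^+)/g\hat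 V_T^+$ and $\hat V_T/g\hat V_T$ are coherent. Let $K(T)$ be the Grothendieck group of coherent $\mathcal O_T$-modules, and for $f\in\bar{\mathcal Q}_S(T)$ put $$[f]:=-\big[(\hat V_T^++f\hat V_T^+)/\hat V_T^+\big]+\big[(\hat V_T^++f\hat V_T^+)/f\hat V_T^+\big]-\big[\hat V_T/f\hat V_T\big]\in K(T).$$ To an inclusion $M_\bullet=(M_0\subseteq M_1)$ of quasi-coherent submodules of $\hat V_T$ with $M_1/M_0$ coherent attach the class $[M_1/M_0]\in K(T)$, and extend this linearly to formal integral combinations of such inclusions. For $g\in\bar{\mathcal Q}_S(T)$ put $g_*M_\bullet:=(gM_0\subseteq gM_1)$, extended linearly to formal combinations. **Theorem.** Let $g,f\in\bar{\mathcal Q}_S(T)$. Then $gf=g\circ f\in\bar{\mathcal Q}_S(T)$; the class of $g_*x$ depends only on the class of the formal combination $x$; the inclusions $\hat V_T^+\subseteq\hat V_T^++f\hat V_T^+$, $f\hat V_T^+\subseteq\hat V_T^++f\hat V_T^+$ and $f\hat V_T\subseteq\hat V_T$ are of the above kind, so that $[f]$ is the class of $-(\hat V_T^+\subseteq\hat V_T^++f\hat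 V_T^+)+(f\hat V_T^+\subseteq\hat V_T^++f\hat V_T^+)-(f\hat V_T\subseteq\hat V_T)$; and, denoting by $g_*[f]$ the class of $g_*$ of this combination, $$g_*[f]=[gf]-[g]\quad\text{in }K(T).$$ -/

import Mathlib

open CategoryTheory CategoryTheory.Limits AlgebraicGeometry

universe u v w

namespace SatoEnlargement

noncomputable section

/-! ## Quotients by subobjects in an abelian category -/

section Abelian

variable {C : Type w} [Category.{v} C] [Abelian C]

/-- The quotient functor `A ↦ W / A` on the subobjects of `W`; for `A ≤ B` it is the projection
`W / A ⟶ W / B`. -/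
def quotFunctor (W : C) : Subobject W ⥤ C where
  obj A := cokernel A.arrow
  map {A B} h := cokernel.map A.arrow B.arrow (Subobject.ofLE A B (leOfHom h)) (𝟙 W) (by simp)
  map_id A := by ext; simp
  map_comp f g := by ext; simp

/-- The constant cone over the quotients of `W`, given by the projections `W ⟶ W / A`. -/
def quotCone (W : C) {J : Type*} [Category J] (I : J ⥤ Subobject W) :
    Cone (I ⋙ quotFunctor W) where
  pt := W
  π :=
    { app := fun A => cokernel.π (I.obj A).arrow
      naturality := fun A B h => by simp [quotFunctor] }

/-- For `i : P ⟶ W`, the natural map `P / i⁻¹(A) ⟶ W / A`. -/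
def quotPullback {P W : C} (i : P ⟶ W) :
    Subobject.pullback i ⋙ quotFunctor P ⟶ quotFunctor W where
  app A := cokernel.map ((Subobject.pullback i).obj A).arrow A.arrow
    (Subobject.pullbackπ i A) i (Subobject.isPullback i A).w.symm
  naturality A B h := by
    apply coequalizer.hom_ext
    simp [quotFunctor]

/-- The subquotient `B / A` for `A ≤ B`. -/
abbrev subquot {W : C} {A B : Subobject W} (h : A ≤ B) : C := cokernel (Subobject.ofLE A B h)

/-- The image `g A` of a subobject `A` of `W` under an endomorphism `g` of `W`. -/
abbrev img {W : C} (g : W ⟶ W) (A : Subobject W) : Subobject W := imageSubobject (A.arrow ≫ g)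

lemma img_mono {W : C} (g : W ⟶ W) {A B : Subobject W} (h : A ≤ B) : img g A ≤ img g B := by
  refine imageSubobject_le _ (Subobject.ofLE A B h ≫ factorThruImageSubobject (B.arrow ≫ g)) ?_
  simp

/-- A monomorphism `g` identifies `A` with `g A`. -/
def imgIso {W : C} (g : W ⟶ W) [Mono g] (A : Subobject W) :
    (A : C) ≅ (img g A : C) :=
  (imageSubobjectIso (A.arrow ≫ g) ≪≫ imageMonoIsoSource (A.arrow ≫ g)).symm

lemma imgIso_hom_arrow {W : C} (g : W ⟶ W) [Mono g] (A : Subobject W) :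
    (imgIso g A).hom ≫ (img g A).arrow = A.arrow ≫ g := by
  simp [imgIso]

/-- A monomorphism `g` identifies `B / A` with `g B / g A`. -/
def subquotImgIso {W : C} (g : W ⟶ W) [Mono g] {A B : Subobject W} (h : A ≤ B) :
    subquot h ≅ subquot (img_mono g h) :=
  cokernel.mapIso _ _ (imgIso g A) (imgIso g B) (by
    rw [← cancel_mono (img g B).arrow]
    simp [imgIso_hom_arrow])

end Abelian

/-! ## Sheaves of modules on a scheme -/

/-- Quasi-coherence. -/
def IsQC {X : Scheme.{u}} (M : X.Modules) : Prop :=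
  SheafOfModules.IsQuasicoherent.{u} (R := X.ringCatSheaf) M

/-- Flatness of a (quasi-coherent) module: the sections over every affine open set are flat. -/
def IsFlat {X : Scheme.{u}} (M : X.Modules) : Prop :=
  ∀ U : X.affineOpens, Module.Flat Γ(X, U.1) Γ(M, U.1)

/-- Locally free of finite type. -/
def IsLFFT {X : Scheme.{u}} (M : X.Modules) : Prop :=
  SheafOfModules.IsLocallyFree.{u} (R := X.ringCatSheaf) M ∧
    SheafOfModules.IsFiniteType.{u} (R := X.ringCatSheaf) M

/-- Coherent sheaves on a locally noetherian scheme: quasi-coherent, and with finitely generated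
sections over every affine open set. -/
structure IsCoh {X : Scheme.{u}} (M : X.Modules) : Prop where
  qcoh : IsQC M
  finite : ∀ U : X.affineOpens, Module.Finite Γ(X, U.1) Γ(M, U.1)

lemma IsQC.of_iso {X : Scheme.{u}} {M N : X.Modules} (e : M ≅ N) (h : IsQC M) : IsQC N :=
  (SheafOfModules.isQuasicoherent X.ringCatSheaf).prop_of_iso e h

lemma IsCoh.of_iso {X : Scheme.{u}} {M N : X.Modules} (e : M ≅ N) (h : IsCoh M) : IsCoh N where
  qcoh := h.qcoh.of_iso e
  finite U := by
    have := h.finite U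
    let l : Γ(M, U.1) →ₗ[Γ(X, U.1)] Γ(N, U.1) :=
      { toFun := fun x => e.hom.app U.1 x
        map_add' := fun x y => map_add _ x y
        map_smul' := fun r x => e.hom.app_smul r x }
    refine Module.Finite.of_surjective l fun y => ⟨e.inv.app U.1 y, ?_⟩
    have : (e.inv ≫ e.hom).app U.1 y = y := by rw [e.inv_hom_id]; rfl
    exact this

/-! ## The Grothendieck group of coherent sheaves -/

/-- The coherent sheaves on `X`. -/
def CohMod (X : Scheme.{u}) : Type (u + 1) := { M : X.Modules // IsCoh M }

/-- The relations `[M₂] = [M₁] + [M₃]`, one for each short exact sequence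
`0 → M₁ → M₂ → M₃ → 0` of coherent sheaves. -/
def kRelations (X : Scheme.{u}) : Set (FreeAbelianGroup (CohMod X)) :=
  { x | ∃ (E : ShortComplex X.Modules) (_ : E.ShortExact)
      (h₁ : IsCoh E.X₁) (h₂ : IsCoh E.X₂) (h₃ : IsCoh E.X₃),
      x = FreeAbelianGroup.of ⟨E.X₂, h₂⟩ - FreeAbelianGroup.of ⟨E.X₁, h₁⟩
        - FreeAbelianGroup.of ⟨E.X₃, h₃⟩ }

/-- The Grothendieck group `K(X)` of coherent sheaves on `X`. -/
abbrev KGroup (X : Scheme.{u}) : Type (u + 1) :=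
  FreeAbelianGroup (CohMod X) ⧸ AddSubgroup.closure (kRelations X)

/-- The class `[M]` in `K(X)` of a coherent sheaf `M`. -/
def kClass {X : Scheme.{u}} (M : X.Modules) (h : IsCoh M) : KGroup X :=
  QuotientAddGroup.mk' (AddSubgroup.closure (kRelations X)) (FreeAbelianGroup.of ⟨M, h⟩)

/-! ## Non-singular curves -/

/-- A (not necessarily complete) non-singular curve over the field `k`: an integral separated
scheme of finite type over `k`, of dimension one, all of whose local rings are regular. -/
structure IsNonsingularCurve {k : Type u} [Field k] {S : Scheme.{u}}
    (p : S ⟶ Spec (CommRingCat.of k)) : Prop where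
  integral : IsIntegral S
  separated : IsSeparated p
  locallyOfFiniteType : LocallyOfFiniteType p
  quasiCompact : QuasiCompact p
  dim_eq_one : topologicalKrullDim S = 1
  regular : ∀ x : S, IsRegularLocalRing (S.presheaf.stalk x)

/-! ## Commensurable submodules, the topology they define, and completions -/

/-- Commensurable submodules `A ∼ B` of `V`: `A` and `B` are quasi-coherent, `V/A`, `V/B`,
`V/(A+B)` and `V/(A∩B)` are flat, and `(A+B)/(A∩B)` is locally free of finite type. -/
structure Commensurable {X : Scheme.{u}} {V : X.Modules} (A B : Subobject V) : Prop where
  qcoh_left : IsQC (A : X.Modules)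
  qcoh_right : IsQC (B : X.Modules)
  flat_left : IsFlat (cokernel A.arrow)
  flat_right : IsFlat (cokernel B.arrow)
  flat_sup : IsFlat (cokernel (A ⊔ B).arrow)
  flat_inf : IsFlat (cokernel (A ⊓ B).arrow)
  lfft : IsLFFT (subquot (inf_le_sup : A ⊓ B ≤ A ⊔ B))

/-- The submodules commensurable with `Vp`, ordered by inclusion; they form the neighbourhoods of
zero that define the `Vp`-topology of `V`. -/
abbrev Nbhd {X : Scheme.{u}} {V : X.Modules} (Vp : Subobject V) : Type (u + 1) :=
  { A : Subobject V // Commensurable A Vp }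

/-- The inclusion of the neighbourhoods into all submodules of `V`. -/
abbrev nbhdIncl {X : Scheme.{u}} {V : X.Modules} (Vp : Subobject V) : Nbhd Vp ⥤ Subobject V :=
  (Subtype.mono_coe (fun A : Subobject V => Commensurable A Vp)).functor

/-- A cone with quasi-coherent apex is a limit in the category of quasi-coherent modules. -/
structure IsQCLimit {X : Scheme.{u}} {J : Type*} [Category J] {F : J ⥤ X.Modules}
    (c : Cone F) : Prop where
  qcoh : IsQC c.pt
  existsUnique_lift : ∀ s : Cone F, IsQC s.pt → ∃! φ : s.pt ⟶ c.pt, ∀ j, φ ≫ c.π.app j = s.π.app j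

/-- The standing assumptions on the pair `(V, Vp)`: the modules `V`, `Vp` and `V / Vp` are flat,
`V` and `Vp` are quasi-coherent, `V` is the union of the submodules `A ∼ Vp`, their intersection
is zero, and `V` is the inverse limit of the quotients `V / A`. -/
structure IsAdmissible {X : Scheme.{u}} (V : X.Modules) (Vp : Subobject V) : Prop where
  qcoh : IsQC V
  qcoh_sub : IsQC (Vp : X.Modules)
  flat : IsFlat V
  flat_sub : IsFlat (Vp : X.Modules)
  flat_quot : IsFlat (cokernel Vp.arrow)
  union : ∀ B : Subobject V, (∀ A : Nbhd Vp, A.1 ≤ B) → B = ⊤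
  separated : ∀ B : Subobject V, IsQC (B : X.Modules) → (∀ A : Nbhd Vp, B ≤ A.1) → B = ⊥
  complete : IsQCLimit (quotCone V (nbhdIncl Vp))

section Completion

variable {S : Scheme.{u}} {V : S.Modules} (Vp : Subobject V) (T : S.Opens)

/-- The inverse system of the `𝒪_T`-modules `(V / A)_T`, for `A ∼ Vp`. -/
abbrev systemV : Nbhd Vp ⥤ T.toScheme.Modules :=
  nbhdIncl Vp ⋙ quotFunctor V ⋙ Scheme.Modules.restrictFunctor T.ι

/-- The inverse system of the `𝒪_T`-modules `(Vp / (A ∩ Vp))_T`, for `A ∼ Vp`. -/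
abbrev systemVp : Nbhd Vp ⥤ T.toScheme.Modules :=
  nbhdIncl Vp ⋙ (Subobject.pullback Vp.arrow ⋙ quotFunctor (Vp : S.Modules)) ⋙
    Scheme.Modules.restrictFunctor T.ι

/-- The natural maps `(Vp / (A ∩ Vp))_T ⟶ (V / A)_T`. -/
abbrev systemIncl : systemVp Vp T ⟶ systemV Vp T :=
  Functor.whiskerLeft (nbhdIncl Vp)
    (Functor.whiskerRight (quotPullback Vp.arrow) (Scheme.Modules.restrictFunctor T.ι))

/-- The completions of `V_T` and of `Vp_T` for the `Vp`-topology, that is the inverse limits of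
`(V / A)_T` and of `(Vp / (A ∩ Vp))_T`. They are unique up to a unique isomorphism. -/
structure Completion where
  coneV : Cone (systemV Vp T)
  isLimitV : IsQCLimit coneV
  coneVp : Cone (systemVp Vp T)
  isLimitVp : IsQCLimit coneVp

namespace Completion

variable {Vp T} (c : Completion Vp T)

/-- The completion `V̂_T`. -/
abbrev hatV : T.toScheme.Modules := c.coneV.pt

/-- The canonical map from the completion of `Vp_T` to `V̂_T`. -/
def incl : c.coneVp.pt ⟶ c.hatV :=
  (c.isLimitV.existsUnique_lift ((Cone.postcompose (systemIncl Vp T)).obj c.coneVp)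
    c.isLimitVp.qcoh).choose

/-- The completion of `Vp_T`, as a submodule of `V̂_T`. -/
def hatVp : Subobject c.hatV := imageSubobject c.incl

end Completion

end Completion

/-! ## The enlarged monoid -/

/-- The monomorphisms `g : W ⟶ W` such that `W / g P` is quasi-coherent and `(P + g P) / P`,
`(P + g P) / g P`, `W / g W` are coherent. -/
structure IsQbar {X : Scheme.{u}} {W : X.Modules} (P : Subobject W) (g : W ⟶ W) : Prop where
  mono : Mono g
  qcoh : IsQC (cokernel (img g P).arrow)
  coh_left : IsCoh (subquot (le_sup_left : P ≤ P ⊔ img g P))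
  coh_right : IsCoh (subquot (le_sup_right : img g P ≤ P ⊔ img g P))
  coh_coker : IsCoh (subquot (le_top : img g ⊤ ≤ ⊤))

/-- The class `[f] = -[(P + f P) / P] + [(P + f P) / f P] - [W / f W]` in `K(X)`. -/
def bracket {X : Scheme.{u}} {W : X.Modules} {P : Subobject W} {f : W ⟶ W} (h : IsQbar P f) :
    KGroup X :=
  -kClass _ h.coh_left + kClass _ h.coh_right - kClass _ h.coh_coker

/-! ## Two-term complexes of submodules, their classes, and push-forward -/

/-- The inclusion `M₀ ⊆ M₁` is a complex of the relevant category: `M₀` and `M₁` are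
quasi-coherent submodules of `W`, and `M₁ / M₀` is coherent. -/
structure IsComplex {X : Scheme.{u}} {W : X.Modules} (M₀ M₁ : Subobject W) : Prop where
  le : M₀ ≤ M₁
  qcoh₀ : IsQC (M₀ : X.Modules)
  qcoh₁ : IsQC (M₁ : X.Modules)
  coh : IsCoh (subquot le)

/-- The complexes `M₀ ⊆ M₁` of submodules of `W`. -/
structure SubComplex {X : Scheme.{u}} (W : X.Modules) where
  M₀ : Subobject W
  M₁ : Subobject W
  isComplex : IsComplex M₀ M₁

namespace SubComplex

variable {X : Scheme.{u}} {W : X.Modules}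

/-- The class of formal integral combinations of complexes, `M₀ ⊆ M₁` having class
`[M₁ / M₀]`. -/
def cls : FreeAbelianGroup (SubComplex W) →+ KGroup X :=
  FreeAbelianGroup.lift fun M => kClass _ M.isComplex.coh

/-- The complex `g M₀ ⊆ g M₁`. -/
def push (g : W ⟶ W) (hg : Mono g) (M : SubComplex W) : SubComplex W where
  M₀ := img g M.M₀
  M₁ := img g M.M₁
  isComplex :=
    { le := img_mono g M.isComplex.le
      qcoh₀ := M.isComplex.qcoh₀.of_iso (imgIso g M.M₀)
      qcoh₁ := M.isComplex.qcoh₁.of_iso (imgIso g M.M₁)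
      coh := M.isComplex.coh.of_iso (subquotImgIso g M.isComplex.le) }

/-- The push-forward `g_*`, extended by linearity. -/
def pushLin (g : W ⟶ W) (hg : Mono g) :
    FreeAbelianGroup (SubComplex W) →+ FreeAbelianGroup (SubComplex W) :=
  FreeAbelianGroup.map (push g hg)

end SubComplex

/-- The combination of complexes
`-(P ⊆ P + f P) + (f P ⊆ P + f P) - (f W ⊆ W)` that defines `[f]`. -/
def formalBracket {X : Scheme.{u}} {W : X.Modules} (P : Subobject W) (f : W ⟶ W)
    (h₁ : IsComplex P (P ⊔ img f P)) (h₂ : IsComplex (img f P) (P ⊔ img f P))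
    (h₃ : IsComplex (img f ⊤) ⊤) : FreeAbelianGroup (SubComplex W) :=
  -FreeAbelianGroup.of ⟨P, P ⊔ img f P, h₁⟩ + FreeAbelianGroup.of ⟨img f P, P ⊔ img f P, h₂⟩
    - FreeAbelianGroup.of ⟨img f ⊤, ⊤, h₃⟩

end

end SatoEnlargement

open SatoEnlargement

open Opposite

namespace SatoEnlargement

/-! Write W for the completion of V and P for that of V⁺. A monomorphism g identifies M₁/M₀ with
gM₁/gM₀, so g_* does not change classes (`cls_pushLin`), and the formula reduces to additivity, [gf]
= [g] + [f].

Here [f] = ind(P, fP) - [W/fW] (`bracket_eq`), where ind(A, B) = -[(A+B)/A] + [(A+B)/B]. The index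
can be computed in any common overmodule with coherent quotients (`relIndex_eq_of_cohLE`), hence it
is additive (`relIndex_add`); it is also invariant under g (`relIndex_img`). So ind(P, gfP) = ind(P,
gP) + ind(gP, gfP) = ind(P, gP) + ind(P, fP). The chain gfW ⊆ gW ⊆ W handles the cokernels.

The remaining work is to keep every subquotient coherent: cokernels, kernels, images and sums of
quasi-coherent modules must be quasi-coherent, and coherence must pass to quasi-coherent submodules,
quotients and extensions on a locally noetherian scheme. -/

/-! ### Quasi-coherent modules on an affine scheme. -/

lemma isQC_iff_essImage_tilde {R : CommRingCat.{u}} {M : (Spec R).Modules} :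
    IsQC M ↔ (tilde.functor R).essImage M := by
  rw [essImage_tilde]
  exact Iff.rfl

lemma exists_tilde_map {R : CommRingCat.{u}} {M N : (Spec R).Modules} (φ : M ⟶ N)
    (hM : IsQC M) (hN : IsQC N) :
    ∃ (A B : ModuleCat.{u} R) (a : A ⟶ B) (eA : (tilde.functor R).obj A ≅ M)
      (eB : (tilde.functor R).obj B ≅ N), (tilde.functor R).map a ≫ eB.hom = eA.hom ≫ φ := by
  obtain ⟨A, ⟨eA⟩⟩ := isQC_iff_essImage_tilde.mp hM
  obtain ⟨B, ⟨eB⟩⟩ := isQC_iff_essImage_tilde.mp hN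
  refine ⟨A, B, (tilde.functor R).preimage (eA.hom ≫ φ ≫ eB.inv), eA, eB, ?_⟩
  rw [Functor.map_preimage]
  simp

lemma IsQC.cokernel_Spec {R : CommRingCat.{u}} {M N : (Spec R).Modules} (φ : M ⟶ N)
    (hM : IsQC M) (hN : IsQC N) : IsQC (cokernel φ) := by
  obtain ⟨A, B, a, eA, eB, h⟩ := exists_tilde_map φ hM hN
  exact isQC_iff_essImage_tilde.mpr ⟨cokernel a,
    ⟨PreservesCokernel.iso (tilde.functor R) a ≪≫ cokernel.mapIso _ _ eA eB h⟩⟩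

/-- Elementwise form of M(D(f)) = M(X)_f. Only extension of sections and killing by powers need
stating, since f always acts invertibly over D(f). -/
lemma isQC_Spec_iff {R : CommRingCat.{u}} {M : (Spec R).Modules} :
    IsQC M ↔ ∀ (f : R) (U : (Spec R).Opens), U = PrimeSpectrum.basicOpen f →
      (∀ s : Γ(M, U), ∃ (n : ℕ) (t : Γ(M, ⊤)), f ^ n • s = M.presheaf.map (homOfLE le_top).op t) ∧
      (∀ t : Γ(M, ⊤), M.presheaf.map (homOfLE (le_top : U ≤ ⊤)).op t = 0 →
        ∃ n : ℕ, f ^ n • t = 0) := by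
  refine (isQuasicoherent_iff_isIso_fromTildeΓ M).trans
    ((isIso_fromTildeΓ_iff_isLocalizing M).trans ⟨fun h f U hU => ?_, fun h f => ?_⟩)
  · subst hU
    have hf : IsLocalizedModule (.powers f) _ := h f
    refine ⟨fun s => ?_, fun t ht => ?_⟩
    · obtain ⟨⟨y, _, n, rfl⟩, hy⟩ := hf.surj s
      exact ⟨n, y, hy⟩
    · obtain ⟨⟨_, n, rfl⟩, hn⟩ := (hf.eq_zero_iff (.powers f) _).mp ht
      exact ⟨n, hn⟩
  · refine IsLocalizedModule.Away.mk_of_addCommGroup ?_ (h f _ rfl).1 (h f _ rfl).2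
    exact Scheme.Modules.isUnit_algebraMap_end_of_le_basicOpen f le_rfl

/-- Sections over `U`, as a functor to abelian groups. -/
noncomputable abbrev sectionsFunctor {X : Scheme.{u}} (U : X.Opens) : X.Modules ⥤ Ab :=
  Scheme.Modules.toPresheaf X ⋙ (evaluation _ _).obj (op U)

instance {X : Scheme.{u}} (U : X.Opens) : (sectionsFunctor U).Additive where
  map_add := rfl

instance {X : Scheme.{u}} (U : X.Opens) : PreservesFiniteLimits (sectionsFunctor U) :=
  have : PreservesFiniteLimits ((evaluation X.Opensᵒᵖ Ab.{u}).obj (op U)) := inferInstance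
  have : PreservesFiniteLimits (Scheme.Modules.toPresheaf X) := inferInstance
  comp_preservesFiniteLimits (Scheme.Modules.toPresheaf X) ((evaluation X.Opensᵒᵖ Ab).obj (op U))

section Sections

variable {X : Scheme.{u}} {E : ShortComplex X.Modules} (U : X.Opens)

lemma app_injective {M N : X.Modules} (φ : M ⟶ N) [Mono φ] : Function.Injective (φ.app U) := by
  have : Mono ((sectionsFunctor U).map φ) := inferInstance
  exact (AddCommGrpCat.mono_iff_injective _).mp this

lemma exists_app_eq (hE : E.Exact) [Mono E.f] (x : Γ(E.X₂, U)) (hx : E.g.app U x = 0) :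
    ∃ y, E.f.app U y = x := by
  have := hE.map_of_mono_of_preservesKernel (sectionsFunctor U) inferInstance inferInstance
  exact (ShortComplex.ab_exact_iff _).mp this x hx

lemma app_map {M N : X.Modules} (φ : M ⟶ N) {U V : X.Opens} (h : U ≤ V) (x : Γ(M, V)) :
    φ.app U (M.presheaf.map (homOfLE h).op x) = N.presheaf.map (homOfLE h).op (φ.app V x) :=
  congr($(φ.mapPresheaf.naturality (homOfLE h).op) x)

end Sections

lemma app_smul_Spec {R : CommRingCat.{u}} {M N : (Spec R).Modules} (φ : M ⟶ N)
    (U : (Spec R).Opens) (r : R) (x : Γ(M, U)) : φ.app U (r • x) = r • φ.app U x := by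
  rw [Scheme.Modules.smul_Spec_def, Scheme.Modules.Hom.app_smul]
  rfl

lemma IsQC.left_of_exact_Spec {R : CommRingCat.{u}} {E : ShortComplex (Spec R).Modules}
    (hE : E.Exact) [Mono E.f] (h₂ : IsQC E.X₂) (h₃ : IsQC E.X₃) : IsQC E.X₁ := by
  rw [isQC_Spec_iff] at h₂ h₃ ⊢
  intro f U hU
  have inj := fun V => app_injective V E.f
  have comp0 : ∀ V x, E.g.app V (E.f.app V x) = 0 := fun V x => by
    have : (E.f ≫ E.g).app V x = 0 := by rw [E.zero]; rfl
    exact this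
  refine ⟨fun s => ?_, fun t ht => ?_⟩
  · obtain ⟨n, t, ht⟩ := (h₂ f U hU).1 (E.f.app U s)
    -- The extension t of fⁿs lies in `E.X₂`. Its image in `E.X₃` vanishes on D(f), so some fᵐ kills
    -- it and fᵐt comes from `E.X₁`.
    obtain ⟨m, hm⟩ := (h₃ f U hU).2 (E.g.app ⊤ t) (by
      rw [← app_map, ← ht, app_smul_Spec, comp0, smul_zero])
    rw [← app_smul_Spec] at hm
    obtain ⟨y, hy⟩ := exists_app_eq ⊤ hE _ hm
    refine ⟨m + n, y, inj _ ?_⟩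
    rw [app_map, hy, Scheme.Modules.map_smul_Spec, ← ht, app_smul_Spec, pow_add, mul_smul]
  · obtain ⟨n, hn⟩ := (h₂ f U hU).2 (E.f.app ⊤ t) (by rw [← app_map, ht, map_zero])
    exact ⟨n, inj _ (by rw [app_smul_Spec, hn, map_zero])⟩

/-- The tilde functor is faithful, so it reflects epimorphisms, and Γ ∘ tilde ≅ id turns them back
into surjections on global sections. -/
lemma app_top_surjective_Spec {R : CommRingCat.{u}} {M N : (Spec R).Modules} (φ : M ⟶ N) [Epi φ]
    (hM : IsQC M) (hN : IsQC N) : Function.Surjective (φ.app ⊤) := by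
  obtain ⟨A, B, a, eA, eB, h⟩ := exists_tilde_map φ hM hN
  have : Epi ((tilde.functor R).map a) := by
    rw [← Iso.eq_comp_inv] at h
    rw [h]
    infer_instance
  have : Epi a := (tilde.functor R).epi_of_epi_map this
  have := Functor.PreservesEpimorphisms.of_iso (tilde.toTildeΓNatIso (R := R))
  have ha : Epi ((tilde.functor R ⋙ moduleSpecΓFunctor).map a) := inferInstance
  have hs : Function.Surjective (((tilde.functor R).map a).app ⊤) :=
    (ModuleCat.epi_iff_surjective ((tilde.functor R ⋙ moduleSpecΓFunctor).map a)).mp ha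
  intro y
  obtain ⟨x, hx⟩ := hs (eB.inv.app ⊤ y)
  refine ⟨eA.hom.app ⊤ x, ?_⟩
  have h3 : (eA.hom ≫ φ).app ⊤ x = ((tilde.functor R).map a ≫ eB.hom).app ⊤ x := by rw [h]
  have h4 : (eB.inv ≫ eB.hom).app ⊤ y = y := by rw [eB.inv_hom_id]; rfl
  refine h3.trans ?_
  rw [← h4]
  exact congr(eB.hom.app ⊤ $hx)

/-! ### Quasi-coherence is detected on affine open sets. -/

instance {X Y : Scheme.{u}} (f : X ⟶ Y) [IsOpenImmersion f] :
    PreservesLimits (Scheme.Modules.restrictFunctor f) := by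
  have : PreservesLimits (Scheme.Modules.restrictFunctor f ⋙ Scheme.Modules.toPresheaf X) :=
    have : PreservesLimits ((Functor.whiskeringLeft _ _ Ab.{u}).obj f.opensFunctor.op) := 
      ⟨⟨inferInstance⟩⟩
    comp_preservesLimits (Scheme.Modules.toPresheaf Y)
      ((Functor.whiskeringLeft _ _ Ab.{u}).obj f.opensFunctor.op)
  have : ReflectsLimits (Scheme.Modules.toPresheaf X) := reflectsLimits_of_reflectsIsomorphisms
  exact preservesLimits_of_reflects_of_preserves _ (Scheme.Modules.toPresheaf X)

lemma Presentation.nonempty_of_iso {X : Scheme.{u}} {M N : X.Modules} (e : M ≅ N)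
    (P : SheafOfModules.Presentation.{u} (R := X.ringCatSheaf) M) :
    Nonempty (SheafOfModules.Presentation.{u} (R := X.ringCatSheaf) N) :=
  have : IsIso (C := SheafOfModules.{u} X.ringCatSheaf) e.hom :=
    ⟨e.inv, e.hom_inv_id, e.inv_hom_id⟩
  ⟨SheafOfModules.Presentation.ofIsIso.{u, u, u} (R := X.ringCatSheaf) e.hom P⟩

/-- A quasi-coherent module on an affine scheme has a global presentation. -/
lemma IsQC.nonempty_presentation_Spec {R : CommRingCat.{u}} {M : (Spec R).Modules} (hM : IsQC M) :
    Nonempty (SheafOfModules.Presentation.{u} (R := (Spec R).ringCatSheaf) M) := by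
  obtain ⟨A, ⟨e⟩⟩ := isQC_iff_essImage_tilde.mp hM
  exact Presentation.nonempty_of_iso e
    (presentationTilde.{u} A .univ (by simp) _ (Submodule.span_eq _))

lemma IsQC.restrict {X Y : Scheme.{u}} {M : Y.Modules} (hM : IsQC M) (f : X ⟶ Y)
    [IsOpenImmersion f] : IsQC (M.restrict f) :=
  have : SheafOfModules.IsQuasicoherent.{u} (R := Y.ringCatSheaf) M := hM
  Scheme.Modules.isQuasicoherent_restrictFunctor f M

/-- The structure sheaf of `U`, seen over the slice site of `U`. -/
noncomputable def unitOverIso {X : Scheme.{u}} (U : X.Opens) :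
    SheafOfModules.unit U.toScheme.ringCatSheaf ≅
      (Scheme.Modules.overEquiv U).functor.obj (SheafOfModules.unit (X.ringCatSheaf.over U)) :=
  (Scheme.Modules.restrictUnitIso U.ι).symm ≪≫
    ((Scheme.Modules.overFunctorEquiv U).app (SheafOfModules.unit X.ringCatSheaf)).symm

lemma nonempty_presentation_over {X : Scheme.{u}} {M : X.Modules} {U : X.Opens}
    (hU : IsAffineOpen U) (hM : IsQC (M.restrict hU.fromSpec)) :
    Nonempty (SheafOfModules.Presentation.{u}
      (SheafOfModules.over.{u} (R := X.ringCatSheaf) M U)) := by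
  obtain ⟨P⟩ := hM.nonempty_presentation_Spec
  let P₁ := Scheme.Modules.presentationRestrict hU.isoSpec.hom P
  let e : (M.restrict hU.fromSpec).restrict hU.isoSpec.hom ≅ M.restrict U.ι :=
    ((Scheme.Modules.restrictFunctorComp hU.isoSpec.hom hU.fromSpec).symm ≪≫
      Scheme.Modules.restrictFunctorCongr (by simp)).app M
  obtain ⟨P₂⟩ := Presentation.nonempty_of_iso e P₁
  -- Transporting a presentation through an equivalence requires matching the structure sheaves on
  -- both sides.
  let η := (Scheme.Modules.overEquiv U).inverse.mapIso (unitOverIso U) ≪≫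
    ((Scheme.Modules.overEquiv U).unitIso.app _).symm
  let F : SheafOfModules.{u} U.toScheme.ringCatSheaf ⥤ SheafOfModules.{u} (X.ringCatSheaf.over U) :=
    (Scheme.Modules.overEquiv U).inverse
  have : F.IsEquivalence := (Scheme.Modules.overEquiv U).isEquivalence_inverse
  have : PreservesColimitsOfSize.{u, u} F := inferInstance
  let Q := P₂.map F η.symm
  let i := (Scheme.Modules.overEquiv U).inverse.mapIso
      ((Scheme.Modules.overFunctorEquiv U).symm.app M) ≪≫
    (Scheme.Modules.overEquiv U).unitIso.symm.app _
  exact ⟨SheafOfModules.Presentation.ofIsIso.{u, u, u} i.hom Q⟩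

lemma isQC_iff_restrict {X : Scheme.{u}} {M : X.Modules} :
    IsQC M ↔ ∀ (U : X.Opens) (hU : IsAffineOpen U), IsQC (M.restrict hU.fromSpec) := by
  refine ⟨fun h U _ => h.restrict _, fun h => ?_⟩
  refine SheafOfModules.QuasicoherentData.isQuasicoherent.{u} (R := X.ringCatSheaf)
    { I := X.affineOpens
      X := fun U => U.1
      coversTop := ?_
      presentation := fun U => (nonempty_presentation_over U.2 (h U.1 U.2)).some }
  rw [Opens.coversTop_iff]
  exact iSup_affineOpens_eq_top X

/-! ### Closure properties of quasi-coherent and coherent modules. -/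

section QuasiCoherent

variable {X : Scheme.{u}}

lemma IsQC.cokernel {M N : X.Modules} (φ : M ⟶ N) (hM : IsQC M) (hN : IsQC N) :
    IsQC (cokernel φ) := by
  rw [isQC_iff_restrict]
  intro U hU
  exact (((hM.restrict _).cokernel_Spec _ (hN.restrict _))).of_iso
    (PreservesCokernel.iso (Scheme.Modules.restrictFunctor hU.fromSpec) φ).symm

lemma IsQC.left_of_exact {E : ShortComplex X.Modules} (hE : E.Exact) [Mono E.f]
    (h₂ : IsQC E.X₂) (h₃ : IsQC E.X₃) : IsQC E.X₁ := by
  rw [isQC_iff_restrict]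
  intro U hU
  have : Mono (E.map (Scheme.Modules.restrictFunctor hU.fromSpec)).f :=
    inferInstanceAs (Mono ((Scheme.Modules.restrictFunctor hU.fromSpec).map E.f))
  exact IsQC.left_of_exact_Spec (E := E.map (Scheme.Modules.restrictFunctor hU.fromSpec))
    (hE.map_of_mono_of_preservesKernel (Scheme.Modules.restrictFunctor hU.fromSpec)
      inferInstance inferInstance)
    (h₂.restrict _) (h₃.restrict _)

lemma IsQC.kernel {M N : X.Modules} (φ : M ⟶ N) (hM : IsQC M) (hN : IsQC N) :
    IsQC (kernel φ) :=
  IsQC.left_of_exact (ShortComplex.exact_kernel φ) hM hN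

lemma IsQC.of_cokernel_arrow {W : X.Modules} {A : Subobject W} (hW : IsQC W)
    (hA : IsQC (Limits.cokernel A.arrow)) : IsQC (A : X.Modules) :=
  IsQC.left_of_exact (ShortComplex.exact_cokernel A.arrow) hW hA

/-- The image is the kernel of the projection to the cokernel. -/
lemma IsQC.imageSubobject {M N : X.Modules} (φ : M ⟶ N) (hM : IsQC M) (hN : IsQC N) :
    IsQC (imageSubobject φ : X.Modules) :=
  (hN.kernel (Limits.cokernel.π φ) (hM.cokernel φ hN)).of_iso
    (Abelian.imageIsoImage φ ≪≫ (imageSubobjectIso φ).symm)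

lemma app_surjective {M N : X.Modules} (φ : M ⟶ N) [Epi φ] (hM : IsQC M) (hN : IsQC N)
    {U : X.Opens} (hU : IsAffineOpen U) : Function.Surjective (φ.app U) := by
  have := app_top_surjective_Spec ((Scheme.Modules.restrictFunctor hU.fromSpec).map φ)
    (hM.restrict _) (hN.restrict _)
  have h : Function.Surjective (φ.app (hU.fromSpec ''ᵁ ⊤)) := this
  rwa [Scheme.Hom.image_top_eq_opensRange, hU.opensRange_fromSpec] at h

/-- The map on sections as a linear map. -/
noncomputable def appₗ {M N : X.Modules} (φ : M ⟶ N) (U : X.Opens) :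
    Γ(M, U) →ₗ[Γ(X, U)] Γ(N, U) where
  toFun := φ.app U
  map_add' := map_add _
  map_smul' r x := φ.app_smul r x

lemma IsCoh.of_mono [IsLocallyNoetherian X] {M N : X.Modules} (φ : M ⟶ N) [Mono φ] (hM : IsQC M)
    (hN : IsCoh N) : IsCoh M where
  qcoh := hM
  finite U := by
    have := hN.finite U
    have : IsNoetherianRing Γ(X, U.1) := IsLocallyNoetherian.component_noetherian U
    exact Module.Finite.of_injective (appₗ φ U.1) (app_injective U.1 φ)

lemma IsCoh.of_epi {M N : X.Modules} (φ : M ⟶ N) [Epi φ] (hM : IsCoh M)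
    (hN : IsQC N) : IsCoh N where
  qcoh := hN
  finite U := by
    have := hM.finite U
    exact Module.Finite.of_surjective (appₗ φ U.1) (app_surjective φ hM.qcoh hN U.2)

lemma IsCoh.of_shortExact [IsLocallyNoetherian X] {E : ShortComplex X.Modules} (hE : E.ShortExact)
    (h₁ : IsCoh E.X₁) (h₂ : IsQC E.X₂) (h₃ : IsCoh E.X₃) : IsCoh E.X₂ where
  qcoh := h₂
  finite U := by
    have := hE.mono_f
    have := h₁.finite U
    have := h₃.finite U
    have : IsNoetherianRing Γ(X, U.1) := IsLocallyNoetherian.component_noetherian U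
    have : IsNoetherian Γ(X, U.1) Γ(E.X₂, U.1) := by
      refine isNoetherian_of_range_eq_ker (appₗ E.f U.1) (appₗ E.g U.1) (le_antisymm ?_ ?_)
      · rintro _ ⟨y, rfl⟩
        have : (E.f ≫ E.g).app U.1 y = 0 := by rw [E.zero]; rfl
        exact this
      · exact fun x hx => exists_app_eq U.1 hE.exact x hx
    infer_instance

end QuasiCoherent

/-! ### Sums, images and subquotients in an abelian category. -/

section Lattice
variable {C : Type w} [Category.{v} C] [Abelian C] {W : C}

/-- The equalizer of `s` and `t`, as a subobject of `W`, contains both A and B, hence A + B. -/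
lemma sup_hom_ext {A B : Subobject W} {Z : C} {s t : ((A ⊔ B : Subobject W) : C) ⟶ Z}
    (hA : Subobject.ofLE A (A ⊔ B) le_sup_left ≫ s = Subobject.ofLE A (A ⊔ B) le_sup_left ≫ t)
    (hB : Subobject.ofLE B (A ⊔ B) le_sup_right ≫ s = Subobject.ofLE B (A ⊔ B) le_sup_right ≫ t) :
    s = t := by
  have h : A ⊔ B ≤ Subobject.mk (equalizer.ι s t ≫ (A ⊔ B).arrow) := sup_le
    (Subobject.le_mk_of_comm (equalizer.lift _ hA) (by simp))
    (Subobject.le_mk_of_comm (equalizer.lift _ hB) (by simp))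
  have h1 : Subobject.ofLEMk _ _ h ≫ equalizer.ι s t = 𝟙 _ := by
    simp [← cancel_mono (A ⊔ B).arrow]
  rw [← Category.id_comp s, ← Category.id_comp t, ← h1, Category.assoc, Category.assoc,
    equalizer.condition]

/-- The six-term kernel-cokernel sequence of a composite, cut short because ker g = 0. -/
lemma cokernel_map_shortExact {X Y Z : C} (f : X ⟶ Y) (g : Y ⟶ Z) (k : X ⟶ Z) (hk : f ≫ g = k)
    [Mono g] : ∃ (i : cokernel f ⟶ cokernel k) (p : cokernel k ⟶ cokernel g) (z : i ≫ p = 0),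
      (ShortComplex.mk i p z).ShortExact := by
  subst hk
  have h := kernelCokernelCompSequence_exact f g
  refine ⟨_, _, _, { exact := h.exact 3, mono_f := ?_, epi_g := ?_ }⟩
  · exact (h.exact 2).mono_g ((isZero_kernel_of_mono g).eq_of_src _ _)
  · exact inferInstanceAs (Epi ((kernelCokernelCompSequence f g).map' 4 5))

lemma subquot_shortExact {A B D : Subobject W} (h : A ≤ B) (h' : B ≤ D) :
    ∃ (i : subquot h ⟶ subquot (h.trans h')) (p : subquot (h.trans h') ⟶ subquot h')
      (z : i ≫ p = 0), (ShortComplex.mk i p z).ShortExact := 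
  cokernel_map_shortExact _ _ _ (Subobject.ofLE_comp_ofLE _ _ _ h h')

/-- B maps onto (B+D)/D, and A ≤ D goes to zero. -/
lemma exists_epi_subquot_sup {A B D : Subobject W} (h : A ≤ B) (h' : A ≤ D):
    ∃ p : subquot h ⟶ subquot (le_sup_right : D ≤ B ⊔ D), Epi p := by
  refine ⟨cokernel.map _ _ (Subobject.ofLE A D h') (Subobject.ofLE B (B ⊔ D) le_sup_left)
    (by simp), ⟨fun {Z} a b hab => ?_⟩⟩
  rw [← cancel_epi (cokernel.π _)]
  rw [← cancel_epi (cokernel.π _), cokernel.π_desc_assoc, cokernel.π_desc_assoc] at hab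
  refine sup_hom_ext (by simpa using hab) ?_
  simp [cokernel.condition_assoc]

lemma img_le_iff (g : W ⟶ W) [Mono g] {A B : Subobject W} :
    img g A ≤ B ↔ A ≤ (Subobject.pullback g).obj B := by
  refine ⟨fun h => ?_, fun h => ?_⟩
  · exact Subobject.le_of_comm ((Subobject.isPullback g B).lift
      ((imgIso g A).hom ≫ Subobject.ofLE _ _ h) A.arrow (by simp [imgIso_hom_arrow]))
      ((Subobject.isPullback g B).lift_snd _ _ _)
  · refine imageSubobject_le _ (Subobject.ofLE _ _ h ≫ Subobject.pullbackπ g B) ?_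
    rw [Category.assoc, (Subobject.isPullback g B).w, Subobject.ofLE_arrow_assoc]

lemma img_sup (g : W ⟶ W) [Mono g] (A B : Subobject W) : img g (A ⊔ B) = img g A ⊔ img g B :=
  GaloisConnection.l_sup (u := (Subobject.pullback g).obj) (fun _ _ => img_le_iff g)

lemma img_comp (f g : W ⟶ W) [Mono f] [Mono g] (A : Subobject W) :
    img (f ≫ g) A = img g (img f A) := by
  refine le_antisymm ?_ ?_
  · refine imageSubobject_le _ ((imgIso f A).hom ≫ (imgIso g _).hom) ?_
    rw [Category.assoc, imgIso_hom_arrow, ← Category.assoc, imgIso_hom_arrow, Category.assoc]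
  · refine imageSubobject_le _ ((imgIso f A).inv ≫ (imgIso (f ≫ g) A).hom) ?_
    rw [Category.assoc, imgIso_hom_arrow, Iso.inv_comp_eq, ← Category.assoc, ← Category.assoc,
      imgIso_hom_arrow]

/-- Presents W/(A+B) as the cokernel of B → W/A, which makes A + B quasi-coherent when W, A and B
are. -/
lemma exists_cokernel_iso_cokernel_sup (A B : Subobject W) :
    ∃ φ : (B : C) ⟶ cokernel A.arrow,
      Nonempty (cokernel φ ≅ cokernel (A ⊔ B).arrow) := by
  refine ⟨B.arrow ≫ cokernel.π A.arrow, ⟨⟨cokernel.desc _ (cokernel.desc _ (cokernel.π _) ?_) ?_,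
    cokernel.desc _ (cokernel.π A.arrow ≫ cokernel.π _) ?_, ?_, ?_⟩⟩⟩
  · rw [← Subobject.ofLE_arrow (le_sup_left : A ≤ A ⊔ B), Category.assoc, cokernel.condition,
      comp_zero]
  · rw [Category.assoc, cokernel.π_desc, ← Subobject.ofLE_arrow (le_sup_right : B ≤ A ⊔ B),
      Category.assoc, cokernel.condition, comp_zero]
  · refine sup_hom_ext ?_ ?_
    · simp
    · rw [Subobject.ofLE_arrow_assoc, comp_zero, ← Category.assoc, cokernel.condition]
  · apply coequalizer.hom_ext
    apply coequalizer.hom_ext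
    simp
  · apply coequalizer.hom_ext
    simp

end Lattice

/-! ### Classes in the Grothendieck group. -/

section GrothendieckGroup

variable {X : Scheme.{u}}

lemma kClass_shortExact {E : ShortComplex X.Modules} (hE : E.ShortExact)
    (h₁ : IsCoh E.X₁) (h₂ : IsCoh E.X₂) (h₃ : IsCoh E.X₃) :
    kClass _ h₂ = kClass _ h₁ + kClass _ h₃ := by
  have : FreeAbelianGroup.of (⟨E.X₂, h₂⟩ : CohMod X) - FreeAbelianGroup.of ⟨E.X₁, h₁⟩
      - FreeAbelianGroup.of ⟨E.X₃, h₃⟩ ∈ AddSubgroup.closure (kRelations X) :=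
    AddSubgroup.subset_closure ⟨E, hE, h₁, h₂, h₃, rfl⟩
  have h : kClass _ h₂ - kClass _ h₁ - kClass _ h₃ = 0 := (QuotientAddGroup.eq_zero_iff _).mpr this
  rwa [sub_sub, sub_eq_zero] at h

lemma kClass_of_iso {M N : X.Modules} (e : M ≅ N) (hM : IsCoh M) (hN : IsCoh N) :
    kClass M hM = kClass N hN := by
  have z : IsZero (cokernel e.hom) := isZero_cokernel_of_epi e.hom
  have hz : IsCoh (cokernel e.hom) := hN.of_epi (cokernel.π e.hom) (hM.qcoh.cokernel _ hN.qcoh)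
  have h₁ := kClass_shortExact (E := ShortComplex.mk e.hom (cokernel.π e.hom) (by simp))
    { exact := ShortComplex.exact_cokernel _ } hM hN hz
  -- For a zero object Z, the sequence Z → Z → Z gives [Z] = [Z] + [Z], so [Z] = 0.
  have h₂ := kClass_shortExact (E := ShortComplex.mk (𝟙 (cokernel e.hom))
      (0 : _ ⟶ cokernel e.hom) (by simp))
    { exact := ShortComplex.exact_of_isZero_X₂ _ z
      epi_g := ⟨fun _ _ _ => z.eq_of_src _ _⟩ } hz hz hz
  have h0 : kClass _ hz = 0 := by simpa using h₂
  rw [h₁, h0, add_zero]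

end GrothendieckGroup

/-! ### The relative index of two submodules. -/

section Index

variable {X : Scheme.{u}} {W : X.Modules}

/-- `A ≤ B` and `B / A` is coherent. -/
def CohLE (A B : Subobject W) : Prop := ∃ h : A ≤ B, IsCoh (subquot h)

open Classical in
/-- The class `[B / A]`, with value zero unless `A ≤ B` and `B / A` is coherent. -/
noncomputable def relClass (A B : Subobject W) : KGroup X :=
  if h : CohLE A B then kClass _ h.choose_spec else 0

lemma relClass_eq {A B : Subobject W} (h : A ≤ B) (hc : IsCoh (subquot h)) :
    relClass A B = kClass _ hc :=
  dif_pos ⟨h, hc⟩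

lemma CohLE.add {A B D : Subobject W} (h : CohLE A B) (h' : CohLE B D) (h'' : CohLE A D) :
    relClass A D = relClass A B + relClass B D := by
  obtain ⟨h, hc⟩ := h
  obtain ⟨h', hc'⟩ := h'
  obtain ⟨h'', hc''⟩ := h''
  obtain ⟨i, p, z, hE⟩ := subquot_shortExact h h'
  rw [relClass_eq h hc, relClass_eq h' hc', relClass_eq h'' hc'']
  exact kClass_shortExact hE hc hc'' hc'

lemma CohLE.trans [IsLocallyNoetherian X] {A B D : Subobject W} (h : CohLE A B) (h' : CohLE B D)
    (hA : IsQC (A : X.Modules)) (hD : IsQC (D : X.Modules)) : CohLE A D := by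
  obtain ⟨h, hc⟩ := h
  obtain ⟨h', hc'⟩ := h'
  obtain ⟨i, p, z, hE⟩ := subquot_shortExact h h'
  exact ⟨h.trans h', .of_shortExact hE hc (hA.cokernel _ hD) hc'⟩

lemma CohLE.of_le_of_le [IsLocallyNoetherian X] {A B D : Subobject W} (h : CohLE A D) (h₁ : A ≤ B)
    (h₂ : B ≤ D) (hA : IsQC (A : X.Modules)) (hB : IsQC (B : X.Modules)) (hD : IsQC (D : X.Modules)) :
    CohLE A B ∧ CohLE B D := by
  obtain ⟨h, hc⟩ := h
  obtain ⟨i, p, z, hE⟩ := subquot_shortExact h₁ h₂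
  have := hE.mono_f
  have := hE.epi_g
  exact ⟨⟨h₁, hc.of_mono i (hA.cokernel _ hB)⟩, ⟨h₂, hc.of_epi p (hB.cokernel _ hD)⟩⟩

lemma CohLE.sup_right {A B D : Subobject W} (h : CohLE A B) (h' : A ≤ D)
    (hD : IsQC (D : X.Modules)) (hBD : IsQC ((B ⊔ D : Subobject W) : X.Modules)) :
    CohLE D (B ⊔ D) := by
  obtain ⟨h, hc⟩ := h
  obtain ⟨p, hp⟩ := exists_epi_subquot_sup h h'
  exact ⟨le_sup_right, hc.of_epi p (hD.cokernel _ hBD)⟩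

lemma CohLE.img {A B : Subobject W} (h : CohLE A B) (g : W ⟶ W) [Mono g] :
    CohLE (img g A) (img g B) := by
  obtain ⟨h, hc⟩ := h
  exact ⟨img_mono g h, hc.of_iso (subquotImgIso g h)⟩

lemma relClass_img {A B : Subobject W} (h : CohLE A B) (g : W ⟶ W) [Mono g] :
    relClass (img g A) (img g B) = relClass A B := by
  obtain ⟨h, hc⟩ := h
  rw [relClass_eq h hc, relClass_eq (img_mono g h) (hc.of_iso (subquotImgIso g h))]
  exact (kClass_of_iso (subquotImgIso g h) _ _).symm

lemma IsQC.sup {A B : Subobject W} (hW : IsQC W) (hA : IsQC (A : X.Modules))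
    (hB : IsQC (B : X.Modules)) : IsQC ((A ⊔ B : Subobject W) : X.Modules) := by
  obtain ⟨φ, ⟨e⟩⟩ := exists_cokernel_iso_cokernel_sup A B
  exact hW.of_cokernel_arrow ((hB.cokernel φ (hA.cokernel _ hW)).of_iso e)

lemma IsQC.img {A : Subobject W} (hA : IsQC (A : X.Modules)) (g : W ⟶ W) [Mono g] :
    IsQC (img g A : X.Modules) :=
  hA.of_iso (imgIso g A)

lemma IsQC.top (hW : IsQC W) : IsQC ((⊤ : Subobject W) : X.Modules) :=
  hW.of_iso (asIso (⊤ : Subobject W).arrow).symm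

/-- `A` and `B` are commensurable up to coherent modules. -/
structure CohComm (A B : Subobject W) : Prop where
  left : CohLE A (A ⊔ B)
  right : CohLE B (A ⊔ B)

/-- The relative index `-[(A + B) / A] + [(A + B) / B]`. -/
noncomputable def relIndex (A B : Subobject W) : KGroup X :=
  -relClass A (A ⊔ B) + relClass B (A ⊔ B)

lemma CohComm.img {A B : Subobject W} (h : CohComm A B) (g : W ⟶ W) [Mono g] :
    CohComm (img g A) (img g B) where
  left := by rw [← img_sup]; exact h.left.img g
  right := by rw [← img_sup]; exact h.right.img g

lemma relIndex_img {A B : Subobject W} (h : CohComm A B) (g : W ⟶ W) [Mono g] :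
    relIndex (img g A) (img g B) = relIndex A B := by
  rw [relIndex, relIndex, ← img_sup, relClass_img h.left, relClass_img h.right]

/-- Passing from A + B to E adds [E/(A+B)] to both terms, and the two contributions cancel. -/
lemma relIndex_eq_of_cohLE [IsLocallyNoetherian X] {A B E : Subobject W} (hW : IsQC W)
    (hA : IsQC (A : X.Modules)) (hB : IsQC (B : X.Modules)) (hE : IsQC (E : X.Modules))
    (hAE : CohLE A E) (hBE : CohLE B E) :
    relIndex A B = -relClass A E + relClass B E := by
  have hs := sup_le hAE.choose hBE.choose
  have hq := hW.sup hA hB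
  obtain ⟨h₁, h₂⟩ := hAE.of_le_of_le le_sup_left hs hA hq hE
  obtain ⟨h₃, -⟩ := hBE.of_le_of_le le_sup_right hs hB hq hE
  rw [h₁.add h₂ hAE, h₃.add h₂ hBE, relIndex]
  abel

/-- (A+B+D)/(A+B) is a quotient of (B+D)/B, and (A+B+D)/(B+D) is one of (A+B)/B; extensions do the
rest. -/
lemma CohComm.cohLE_sup_sup [IsLocallyNoetherian X] {A B D : Subobject W} (hW : IsQC W)
    (hA : IsQC (A : X.Modules)) (hB : IsQC (B : X.Modules)) (hD : IsQC (D : X.Modules))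
    (h : CohComm A B) (h' : CohComm B D) :
    CohLE A (A ⊔ B ⊔ D) ∧ CohLE B (A ⊔ B ⊔ D) ∧ CohLE D (A ⊔ B ⊔ D) := by
  have hAB := hW.sup hA hB
  have hBD := hW.sup hB hD
  have e : B ⊔ D ⊔ (A ⊔ B) = A ⊔ B ⊔ D := by
    rw [sup_comm, sup_assoc, ← sup_assoc B B D, sup_idem, ← sup_assoc]
  have e' : A ⊔ B ⊔ (B ⊔ D) = A ⊔ B ⊔ D := by rw [sup_comm, e]
  have hABD := hW.sup hAB hD
  have h₁ : CohLE (A ⊔ B) (A ⊔ B ⊔ D) := by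
    rw [← e]
    exact h'.left.sup_right le_sup_right hAB (e ▸ hABD)
  have h₂ : CohLE (B ⊔ D) (A ⊔ B ⊔ D) := by
    rw [← e']
    exact h.right.sup_right le_sup_left hBD (e' ▸ hABD)
  exact ⟨h.left.trans h₁ hA hABD, h.right.trans h₁ hB hABD, h'.right.trans h₂ hD hABD⟩

lemma CohComm.trans [IsLocallyNoetherian X] {A B D : Subobject W} (hW : IsQC W)
    (hA : IsQC (A : X.Modules)) (hB : IsQC (B : X.Modules)) (hD : IsQC (D : X.Modules))
    (h : CohComm A B) (h' : CohComm B D) : CohComm A D := by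
  obtain ⟨h₁, h₂, h₃⟩ := h.cohLE_sup_sup hW hA hB hD h'
  have hs : A ⊔ D ≤ A ⊔ B ⊔ D := sup_le_sup_right le_sup_left D
  have hE := hW.sup (hW.sup hA hB) hD
  have hAD := hW.sup hA hD
  exact ⟨(h₁.of_le_of_le le_sup_left hs hA hAD hE).1, (h₃.of_le_of_le le_sup_right hs hD hAD hE).1⟩

lemma relIndex_add [IsLocallyNoetherian X] {A B D : Subobject W} (hW : IsQC W)
    (hA : IsQC (A : X.Modules)) (hB : IsQC (B : X.Modules)) (hD : IsQC (D : X.Modules))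
    (h : CohComm A B) (h' : CohComm B D) :
    relIndex A D = relIndex A B + relIndex B D := by
  obtain ⟨h₁, h₂, h₃⟩ := h.cohLE_sup_sup hW hA hB hD h'
  have hE := hW.sup (hW.sup hA hB) hD
  rw [relIndex_eq_of_cohLE hW hA hD hE h₁ h₃, relIndex_eq_of_cohLE hW hA hB hE h₁ h₂,
    relIndex_eq_of_cohLE hW hB hD hE h₂ h₃]
  abel

end Index

/-! ### Push-forward preserves classes. -/

namespace SubComplex

variable {X : Scheme.{u}} {W : X.Modules}

lemma cls_pushLin (g : W ⟶ W) (hg : Mono g) (x : FreeAbelianGroup (SubComplex W)) :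
    cls (pushLin g hg x) = cls x := by
  have : cls.comp (pushLin g hg) = cls (W := W) := by
    ext M
    simp only [cls, pushLin, AddMonoidHom.comp_apply, FreeAbelianGroup.map_of_apply,
      FreeAbelianGroup.lift_apply_of]
    exact (kClass_of_iso (subquotImgIso g M.isComplex.le) _ _).symm
  exact congr($this x)

end SubComplex

/-! ### Composition in the enlarged monoid and additivity of the bracket. -/

section Monoid

variable {X : Scheme.{u}} {W : X.Modules} {P : Subobject W} {f g : W ⟶ W}

lemma IsQbar.cohComm (h : IsQbar P f) : CohComm P (img f P) :=
  ⟨⟨_, h.coh_left⟩, ⟨_, h.coh_right⟩⟩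

lemma IsQbar.cohLE_top (h : IsQbar P f) : CohLE (img f ⊤) ⊤ := ⟨_, h.coh_coker⟩

lemma bracket_eq (h : IsQbar P f) :
    bracket h = relIndex P (img f P) - relClass (img f ⊤) ⊤ := by
  rw [bracket, relIndex, relClass_eq _ h.coh_left, relClass_eq _ h.coh_right,
    relClass_eq _ h.coh_coker]

lemma IsQbar.comp [IsLocallyNoetherian X] (hW : IsQC W) (hP : IsQC (P : X.Modules))
    (hf : IsQbar P f) (hg : IsQbar P g) :   IsQbar P (f ≫ g) := by
  have := hf.mono
  have := hg.mono
  -- Commensurability runs along P, gP, gfP; the second link is g applied to P, fP.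
  have h := hg.cohComm.trans hW hP (hP.img g) ((hP.img f).img g) (hf.cohComm.img g)
  have h' := (hf.cohLE_top.img g).trans hg.cohLE_top ((hW.top.img f).img g) hW.top
  rw [← img_comp] at h h'
  exact ⟨inferInstance, (hP.img (f ≫ g)).cokernel _ hW, h.left.choose_spec, h.right.choose_spec,
    h'.choose_spec⟩

lemma bracket_comp [IsLocallyNoetherian X] (hW : IsQC W) (hP : IsQC (P : X.Modules))
    (hf : IsQbar P f) (hg : IsQbar P g) (hfg : IsQbar P (f ≫ g)) :
    bracket hf = bracket hfg - bracket hg := by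
  have := hf.mono
  have := hg.mono
  have hc := hf.cohLE_top.img g
  have hfg' := hfg.cohLE_top
  rw [img_comp] at hfg'
  rw [bracket_eq, bracket_eq, bracket_eq, img_comp, img_comp,
    relIndex_add hW hP (hP.img g) ((hP.img f).img g) hg.cohComm (hf.cohComm.img g),
    relIndex_img hf.cohComm, hc.add hg.cohLE_top hfg', relClass_img hf.cohLE_top]
  abel

lemma IsQbar.isComplex (hW : IsQC W) (hP : IsQC (P : X.Modules)) (hf : IsQbar P f) :
    IsComplex P (P ⊔ img f P) ∧ IsComplex (img f P) (P ⊔ img f P) ∧ IsComplex (img f ⊤) ⊤ :=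
  have := hf.mono
  ⟨⟨le_sup_left, hP, hW.sup hP (hP.img f), hf.coh_left⟩,
    ⟨le_sup_right, hP.img f, hW.sup hP (hP.img f), hf.coh_right⟩,
    ⟨le_top, hW.top.img f, hW.top, hf.coh_coker⟩⟩

lemma cls_formalBracket (hf : IsQbar P f) (h₁ : IsComplex P (P ⊔ img f P))
    (h₂ : IsComplex (img f P) (P ⊔ img f P)) (h₃ : IsComplex (img f ⊤) ⊤) :
    SubComplex.cls (formalBracket P f h₁ h₂ h₃) = bracket hf := by
  simp only [formalBracket, SubComplex.cls, map_sub, map_add, map_neg,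
    FreeAbelianGroup.lift_apply_of]
  rfl

end Monoid

/-! ### Application to the completion on a curve. -/

lemma Completion.isQC_hatVp {S : Scheme.{u}} {V : S.Modules} {Vp : Subobject V} {T : S.Opens}
    (c : Completion Vp T) : IsQC (c.hatVp : T.toScheme.Modules) :=
  c.isLimitVp.qcoh.imageSubobject c.incl c.isLimitV.qcoh

lemma IsNonsingularCurve.isLocallyNoetherian {k : Type u} [Field k] {S : Scheme.{u}}
    {p : S ⟶ Spec (CommRingCat.of k)} (hS : IsNonsingularCurve p) : IsLocallyNoetherian S :=
  have := hS.locallyOfFiniteType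
  have : IsNoetherianRing (CommRingCat.of k) := inferInstanceAs (IsNoetherianRing k)
  LocallyOfFiniteType.isLocallyNoetherian p

end SatoEnlargement

open SatoEnlargement
theorem mainTheorem10 {k : Type u} [Field k] [IsAlgClosed k] (S : Scheme.{u})
    (p : S ⟶ Spec (CommRingCat.of k)) (hS : IsNonsingularCurve p)
    (V : S.Modules) (Vp : Subobject V) (hV : IsAdmissible V Vp)
    (T : S.Opens) (c : Completion Vp T) (g f : c.hatV ⟶ c.hatV)
    (hg : IsQbar c.hatVp g) (hf : IsQbar c.hatVp f) :
    ∃ (hgf : IsQbar c.hatVp (f ≫ g))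
      (h₁ : IsComplex c.hatVp (c.hatVp ⊔ img f c.hatVp))
      (h₂ : IsComplex (img f c.hatVp) (c.hatVp ⊔ img f c.hatVp))
      (h₃ : IsComplex (img f (⊤ : Subobject c.hatV)) ⊤),
      SubComplex.cls (formalBracket c.hatVp f h₁ h₂ h₃) = bracket hf ∧
      (∀ x y : FreeAbelianGroup (SubComplex c.hatV), SubComplex.cls x = SubComplex.cls y →
        SubComplex.cls (SubComplex.pushLin g hg.mono x) =
          SubComplex.cls (SubComplex.pushLin g hg.mono y)) ∧
      SubComplex.cls (SubComplex.pushLin g hg.mono (formalBracket c.hatVp f h₁ h₂ h₃)) =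
        bracket hgf - bracket hg := by
  have := hS.isLocallyNoetherian
  have hW : IsQC c.hatV := c.isLimitV.qcoh
  have hP := c.isQC_hatVp
  have hgf := hf.comp hW hP hg
  obtain ⟨h₁, h₂, h₃⟩ := hf.isComplex hW hP
  refine ⟨hgf, h₁, h₂, h₃, cls_formalBracket hf h₁ h₂ h₃, fun x y h => ?_, ?_⟩
  · rw [SubComplex.cls_pushLin, SubComplex.cls_pushLin, h]
  · rw [SubComplex.cls_pushLin, cls_formalBracket hf, bracket_comp hW hP hf hg hgf]
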